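/- Let $T$ be a theory in a countable first-order language $L$, let $M$ be a model of $T$, and let $U\succeq M$ be a monster model, i.e. a $\kappa$-saturated elementary extension of $M$ for some uncountable $\kappa>|M|$ (every complete type in finitely many variables over a subset of $U$ of size $<\kappa$ is realized in $U$). Below, $x,y$ are arbitrary finite tuples of variables, and tuples are finite. **Eventually stable.** - An $L$-formula $\varphi(x,y)$ is *stable in $M$* if there are no sequences $(a_i)_{i<\omega}$, $(b_j)_{j<\omega}$ of tuples of $M$ such that, for all $i,j$, $M\models\varphi(a_i,b_j)$ if and only if $i<j$. - $M$ is *eventually dependent* if every sequence $(c_i)_{i<\omega}$ of tuples of $M$ of a fixed finite length has a subsequence $(a_i)_{i<\omega}$ such that for every $L$-formula $\varphi(x,y)$ (with $|x|$ equal to the length of the $c_i$) there are $N\in\mathbb N$ and $E\subseteq\{1,\dots,N\}$ such that for all $i_1<\dots<i_N<\omega$, $$M\models\neg\exists y\Big(\bigwedge_{k\in E}\varphi(a_{i_k},y)\wedge\bigwedge_{k\notin E}\neg\varphi(a_{i_k},y)\Big).$$ - $M$ is *eventually stable* if every $L$-formula $\varphi(x,y)$ is stable in $M$ and $M$ is eventually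 dependent. **Generically stable.** A *global type* is a complete type $p(x)$ over $U$. - $p$ is *finitely satisfiable in $M$* if every formula in $p$ is satisfied by a tuple of $M$. - For a linear order $I$, a sequence $(a_i)_{i\in I}$ of tuples of $U$ is a *Morley sequence of $p$ over $M$* if, for each $i\in I$, $a_i$ satisfies all formulas of $p$ with parameters in $M\cup\{a_j:j<i\}$. - $p$ is *generically stable over $M$* if it is finitely satisfiable in $M$ and, for every Morley sequence $(a_i)_{i<\omega+\omega}$ of $p$ over $M$ and every formula $\phi(x)$ with parameters in $U$, the set $\{i<\omega+\omega : U\models\phi(a_i)\}$ is finite or cofinite. **Theorem.** The following are equivalent: 1. $M$ is eventually stable. 2. Every complete type over $M$ (in finitely many variables) extends to a global type that is generically stable over $M$. -/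

import Mathlib

open FirstOrder FirstOrder.Language Cardinal

universe u v w

namespace EventualStability

variable (L : FirstOrder.Language.{u, v})

section Models

variable (M : Type w) [L.Structure M]

variable {L} in
/-- The partitioned formula `φ(x, y)` has the order property in `M`: there are sequences `(aᵢ)`,
`(bⱼ)` of tuples of `M` such that `M ⊨ φ(aᵢ, bⱼ)` if and only if `i < j`. -/
def HasOrderProperty {n m : ℕ} (φ : L.Formula (Fin n ⊕ Fin m)) : Prop :=
  ∃ (a : ℕ → Fin n → M) (b : ℕ → Fin m → M),
    ∀ i j : ℕ, φ.Realize (Sum.elim (a i) (b j)) ↔ i < j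

variable {L} in
/-- The formula `φ(x, y)` is stable in `M` if it does not have the order property in `M`. -/
def StableIn {n m : ℕ} (φ : L.Formula (Fin n ⊕ Fin m)) : Prop :=
  ¬ HasOrderProperty M φ

variable {L M} in
/-- The formula `φ(x, y)` is dependent along the sequence `(aᵢ)`: for some `N`, some pattern
`E ⊆ {0, …, N - 1}` is omitted on all increasing `N`-tuples of indices, i.e. for all
`i₀ < ⋯ < i_{N-1}` we have `M ⊨ ¬ ∃ y, ⋀_{k ∈ E} φ(a_{i_k}, y) ∧ ⋀_{k ∉ E} ¬ φ(a_{i_k}, y)`. -/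
def DependentAlong {n m : ℕ} (φ : L.Formula (Fin n ⊕ Fin m)) (a : ℕ → Fin n → M) : Prop :=
  ∃ (N : ℕ) (E : Set (Fin N)), ∀ i : Fin N → ℕ, StrictMono i →
    ¬ ∃ b : Fin m → M, ∀ k : Fin N, φ.Realize (Sum.elim (a (i k)) b) ↔ k ∈ E

/-- `M` is eventually dependent (eventually NIP): every sequence of finite tuples of `M` (of a
fixed length) has a subsequence along which every formula is dependent. -/
def EventuallyDependent : Prop :=
  ∀ (n : ℕ) (c : ℕ → Fin n → M), ∃ g : ℕ → ℕ, StrictMono g ∧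
    ∀ (m : ℕ) (φ : L.Formula (Fin n ⊕ Fin m)), DependentAlong φ (c ∘ g)

/-- `M` is eventually stable: every formula is stable in `M`, and `M` is eventually dependent. -/
def EventuallyStable : Prop :=
  (∀ (n m : ℕ) (φ : L.Formula (Fin n ⊕ Fin m)), StableIn M φ) ∧ EventuallyDependent L M

end Models

section Types

variable {U : Type w} [L.Structure U]

/-- `S_n(A)`: complete types over the parameter set `A ⊆ U` in the variables `x₀, …, x_{n-1}`,
i.e. complete types of the elementary diagram of `A` in `U`. -/
abbrev TypeOver (A : Set U) (n : ℕ) :=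
  (L[[A]].completeTheory U).CompleteType (Fin n)

/-- Global types: complete types over the whole of `U`. -/
abbrev GlobalType (U : Type w) [L.Structure U] (n : ℕ) :=
  TypeOver L (Set.univ : Set U) n

variable {L}

/-- The set of all formulas `φ(x)` with parameters in `A` that belong to the type `p`. -/
def TypeOver.formulas {A : Set U} {n : ℕ} (p : TypeOver L A n) : Set (L[[A]].Formula (Fin n)) :=
  {φ | Formula.equivSentence φ ∈ p}

/-- A formula with parameters in `A`, read as a formula with parameters in `U`. -/
def toGlobal {A : Set U} {n : ℕ} (φ : L[[A]].Formula (Fin n)) :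
    L[[(Set.univ : Set U)]].Formula (Fin n) :=
  (L.lhomWithConstantsMap (Set.inclusion (Set.subset_univ A))).onFormula φ

/-- The global type `p` extends the type `q` over `A`. -/
def Extends {A : Set U} {n : ℕ} (p : GlobalType L U n) (q : TypeOver L A n) : Prop :=
  ∀ φ ∈ TypeOver.formulas q, toGlobal φ ∈ TypeOver.formulas p

/-- The tuple `a` satisfies all formulas of the global type `p` with parameters in `A`. -/
def RealizesOver {n : ℕ} (p : GlobalType L U n) (A : Set U) (a : Fin n → U) : Prop :=
  ∀ φ : L[[A]].Formula (Fin n), toGlobal φ ∈ TypeOver.formulas p → φ.Realize a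

/-- The global type `p` is finitely satisfiable in `A`. -/
def FinitelySatisfiableIn {n : ℕ} (p : GlobalType L U n) (A : Set U) : Prop :=
  ∀ φ ∈ TypeOver.formulas p, ∃ a : Fin n → U, (∀ k, a k ∈ A) ∧ φ.Realize a

/-- `(aᵢ)`, indexed by a linear order, is a Morley sequence of `p` over `A`: each `aᵢ` realizes
`p` restricted to the union of `A` and (the entries of) all `aⱼ` with `j < i`. -/
def IsMorleySequence {n : ℕ} (p : GlobalType L U n) (A : Set U) {I : Type*} [LinearOrder I]
    (a : I → Fin n → U) : Prop :=
  ∀ i : I, RealizesOver p (A ∪ {x | ∃ j < i, ∃ k, x = a j k}) (a i)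

/-- The global type `p` is generically stable over `A`: it is finitely satisfiable in `A`, and
for each Morley sequence of `p` over `A` of order type `ω + ω` (the lexicographic sum of two copies
of `ℕ`), each formula with parameters in `U` holds on a finite or cofinite part of the sequence. -/
def GenericallyStableOver {n : ℕ} (p : GlobalType L U n) (A : Set U) : Prop :=
  FinitelySatisfiableIn p A ∧
    ∀ a : ℕ ⊕ₗ ℕ → Fin n → U, IsMorleySequence p A a →
      ∀ φ : L[[(Set.univ : Set U)]].Formula (Fin n),
        {i | φ.Realize (a i)}.Finite ∨ {i | ¬ φ.Realize (a i)}.Finite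

variable (L U) in
/-- `U` is `κ`-saturated: it realizes all complete types in finitely many variables over parameter
sets of cardinality less than `κ`. -/
def IsSaturated (κ : Cardinal.{w}) : Prop :=
  ∀ A : Set U, #A < κ → ∀ (n : ℕ) (p : TypeOver L A n),
    ∃ a : Fin n → U, ∀ φ ∈ TypeOver.formulas p, φ.Realize a

end Types

end EventualStability

/-!
A global type that is finitely satisfiable in `M` is the limit of an ultrafilter on the tuples of
`M`, and conversely, so types over a set `A` are handled here as ultrafilters `𝒰`, restricted to the
`A`-definable sets. A Morley sequence of the type is a sequence whose members realize `𝒰` over `M`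
and the earlier members. Every relation that holds in the iterated limit `∀ᶠ x₀, ∀ᶠ x₁, …` along
`𝒰` can be imposed on the increasing tuples of a sequence of approximations, for countably many
relations at a time and up to finite initial segments (`exists_seq_of_iterEventually`).

Stability of all formulas in `M` means that iterated limits along ultrafilters on tuples of `M`
commute (`eventually_comm_of_stableIn`), and it follows that they commute also for sets with
parameters in `U` (`eventually_comm_of_stableIn_of_definable`). Hence independence is symmetric
(`Realizes.symm`), Morley sequences are totally indiscernible over `M`
(`iterEventually_iff_of_injective`), and types over `M` have only one coheir
(`mem_of_agree_of_stableIn`).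

If `M` is eventually stable, then the coheir of a type over `M` is generically stable
(`genericallyStableOver_of_eventuallyStable`). Otherwise some instance `φ(x, b)` holds infinitely
often and fails infinitely often along a Morley sequence; by total indiscernibility every pattern of
`φ` is realized in the iterated limit, hence along increasing tuples of a suitable sequence in `M`
and of all its subsequences, up to initial segments. This contradicts eventual dependence.

Conversely, a generically stable type commutes with every coheir
(`eventually_comm_of_genericallyStable`). If all types over `M` extend to generically stable ones,
then the limits of the two sequences of an order property can be replaced by generically stable ones
and thus commute, which is absurd (`stableIn_of_genericallyStable`). Given a sequence in `M`, its
limit along a nonprincipal ultrafilter is then the unique coheir, so it is generically stable. A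
subsequence is chosen that shows the same patterns as the iterated limit. If a formula is not
dependent along it, then all patterns are realized on a Morley sequence of order type `ω + ω`, and
by saturation some instance of the formula holds exactly on the first half, contradicting generic
stability (`eventuallyDependent_of_genericallyStable`).
-/

namespace EventualStability

open Set Filter

/-! ### Iterated ultrafilter limits -/

/-- The iterated limit `∀ᶠ x₀, ∀ᶠ x₁, …, ∀ᶠ xₖ₋₁, P (x₀, …, xₖ₋₁)` along the ultrafilter `𝒲`; the
outermost quantifier binds the first coordinate. -/
def IterEventually {I : Type*} (𝒲 : Ultrafilter I) : (k : ℕ) → ((Fin k → I) → Prop) → Prop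
  | 0, P => P Fin.elim0
  | k + 1, P => ∀ᶠ x in 𝒲, IterEventually 𝒲 k fun e => P (Fin.cons x e)

theorem iterEventually_not {I : Type*} (𝒲 : Ultrafilter I) (k : ℕ) (P : (Fin k → I) → Prop) :
    IterEventually 𝒲 k (fun e => ¬ P e) ↔ ¬ IterEventually 𝒲 k P := by
  induction k with
  | zero => rfl
  | succ k ih =>
    simp only [IterEventually, ← Ultrafilter.eventually_not]
    exact eventually_congr (Eventually.of_forall fun x => ih _)

theorem iterEventually_map {I J : Type*} (𝒲 : Ultrafilter I) (f : I → J) (k : ℕ)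
    (P : (Fin k → J) → Prop) :
    IterEventually (𝒲.map f) k P ↔ IterEventually 𝒲 k fun e => P (f ∘ e) := by
  induction k with
  | zero =>
    simp only [IterEventually]
    rw [Subsingleton.elim (f ∘ Fin.elim0) Fin.elim0]
  | succ k ih =>
    simp only [IterEventually, Ultrafilter.coe_map, eventually_map, ih]
    refine eventually_congr (Eventually.of_forall fun x => ?_)
    simp only [Fin.comp_cons]

/-- A countable family of relations, each of which holds as an iterated limit along an
ultrafilter, holds from some index on along the increasing tuples of a suitable sequence.
The sequence is built greedily: at each stage finitely many relations, with earlier members of the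
sequence substituted for their first variables, have to hold as iterated limits. -/
theorem exists_seq_of_iterEventually {I ι : Type*} [Countable ι] (𝒲 : Ultrafilter I)
    (k : ι → ℕ) (P : (s : ι) → (Fin (k s) → I) → Prop)
    (hP : ∀ s, IterEventually 𝒲 (k s) (P s)) :
    ∃ g : ℕ → I, ∀ s, ∃ K : ℕ, ∀ i : Fin (k s) → ℕ, StrictMono i → (∀ l, K ≤ i l) →
      P s (g ∘ i) := by
  classical
  -- A stage is a list of relations holding as iterated limits; `y l` is a next member suiting all
  -- relations in `l`, and `sub l` consists of those relations with `y l` substituted.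
  let Rel := {x : Σ k, ((Fin k → I) → Prop) // IterEventually 𝒲 x.1 x.2}
  have hstep : ∀ l : List Rel, ∃ x : I, ∀ r ∈ l, ∀ (j : ℕ) (Q : (Fin (j + 1) → I) → Prop),
      r.1 = ⟨j + 1, Q⟩ → IterEventually 𝒲 j fun e => Q (Fin.cons x e) := by
    intro l
    have : ∀ᶠ x in (𝒲 : Filter I), ∀ r ∈ l, ∀ (j : ℕ) (Q : (Fin (j + 1) → I) → Prop),
        r.1 = ⟨j + 1, Q⟩ → IterEventually 𝒲 j fun e => Q (Fin.cons x e) := by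
      induction l with
      | nil => simp
      | cons r l ih =>
        simp only [List.forall_mem_cons]
        refine Eventually.and ?_ ih
        obtain ⟨⟨m, R⟩, hr⟩ := r
        cases m with
        | zero => refine Eventually.of_forall fun x j Q h => ?_; simp at h
        | succ m =>
          filter_upwards [hr] with x hx j Q h
          cases h
          exact hx
    exact this.exists
  choose y hy using hstep
  let sub (l : List Rel) : List Rel := l.flatMap fun r => match r with
    | ⟨⟨0, _⟩, _⟩ => []
    | ⟨⟨j + 1, Q⟩, _⟩ => if h : IterEventually 𝒲 j (fun e => Q (Fin.cons (y l) e)) then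
        [⟨⟨j, fun e => Q (Fin.cons (y l) e)⟩, h⟩] else []
  obtain ⟨enc, henc⟩ := exists_injective_nat ι
  let new (t : ℕ) : List Rel := if h : ∃ s, enc s = t then
    [⟨⟨k h.choose, P h.choose⟩, hP _⟩] else []
  let F : ℕ → List Rel := fun t => Nat.rec [] (fun t l => new t ++ (l ++ sub l)) t
  have hF : ∀ t, F (t + 1) = new t ++ (F t ++ sub (F t)) := fun t => rfl
  have hmono : ∀ t t', t ≤ t' → ∀ r ∈ F t, r ∈ F t' := by
    intro t t' h r hr
    induction t', h using Nat.le_induction with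
    | base => exact hr
    | succ t' _ ih => rw [hF]; simp [ih]
  have hsub : ∀ t (j : ℕ) (Q : (Fin (j + 1) → I) → Prop) (h : IterEventually 𝒲 (j + 1) Q),
      (⟨⟨j + 1, Q⟩, h⟩ : Rel) ∈ F t → ∃ h' : IterEventually 𝒲 j fun e => Q (Fin.cons (y (F t)) e),
        (⟨⟨j, fun e => Q (Fin.cons (y (F t)) e)⟩, h'⟩ : Rel) ∈ F (t + 1) := by
    intro t j Q h hQ
    have h' := hy (F t) _ hQ j Q rfl
    refine ⟨h', ?_⟩
    rw [hF]
    simp only [List.mem_append]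
    refine Or.inr (Or.inr (List.mem_flatMap.2 ⟨_, hQ, ?_⟩))
    simp [h']
  have key : ∀ (j : ℕ) (Q : (Fin j → I) → Prop) (h : IterEventually 𝒲 j Q) (t : ℕ),
      (⟨⟨j, Q⟩, h⟩ : Rel) ∈ F t → ∀ i : Fin j → ℕ, StrictMono i → (∀ l, t ≤ i l) →
        Q ((fun t => y (F t)) ∘ i) := by
    intro j
    induction j with
    | zero =>
      intro Q h t _ i _ _
      rw [Subsingleton.elim ((fun t => y (F t)) ∘ i) Fin.elim0]
      exact h
    | succ j ih =>
      intro Q h t hQ i hi hti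
      obtain ⟨h', hmem⟩ := hsub (i 0) j Q h (hmono t _ (hti 0) _ hQ)
      have := ih _ h' _ hmem (fun l => i l.succ) (fun a b hab => hi (by simpa using hab))
        (fun l => hi (Fin.succ_pos l))
      convert this using 1
      funext l
      refine Fin.cases ?_ (fun l => ?_) l <;> simp
  refine ⟨fun t => y (F t), fun s => ⟨enc s + 1, fun i hi hK => key _ _ (hP s) _ ?_ i hi hK⟩⟩
  rw [hF]
  have hex : ∃ s', enc s' = enc s := ⟨s, rfl⟩
  have hs : hex.choose = s := henc hex.choose_spec
  refine List.mem_append_left _ ?_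
  simp only [new, dif_pos hex, List.mem_singleton]
  rw! [hs]
  rfl

theorem exists_ultrafilter_of_inter {X : Type*} (𝒮 : Set (Set X)) (C : Set X)
    (hne : 𝒮.Nonempty) (hinter : ∀ S ∈ 𝒮, ∀ T ∈ 𝒮, S ∩ T ∈ 𝒮) (hC : ∀ S ∈ 𝒮, (S ∩ C).Nonempty) :
    ∃ 𝒰 : Ultrafilter X, C ∈ 𝒰 ∧ ∀ S ∈ 𝒮, S ∈ 𝒰 := by
  let f : Filter X :=
    { sets := {Y | ∃ S ∈ 𝒮, S ∩ C ⊆ Y}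
      univ_sets := ⟨_, hne.some_mem, subset_univ _⟩
      sets_of_superset := fun ⟨S, hS, h⟩ h' => ⟨S, hS, h.trans h'⟩
      inter_sets := fun ⟨S, hS, h⟩ ⟨T, hT, h'⟩ => ⟨S ∩ T, hinter S hS T hT,
        fun _ hx => ⟨h ⟨hx.1.1, hx.2⟩, h' ⟨hx.1.2, hx.2⟩⟩⟩ }
  have : NeBot f := ⟨fun h => by
    have h0 : (∅ : Set X) ∈ f := h ▸ mem_bot
    obtain ⟨S, hS, h⟩ := h0
    obtain ⟨x, hx⟩ := hC S hS
    exact h hx⟩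
  refine ⟨Ultrafilter.of f, Ultrafilter.of_le f ?_, fun S hS => Ultrafilter.of_le f ?_⟩
  · exact ⟨_, hne.some_mem, inter_subset_right⟩
  · exact ⟨S, hS, inter_subset_left⟩

/-! ### Definable sets -/

section Definable

variable {L : FirstOrder.Language.{u, v}} {U : Type w} [L.Structure U]

/-- Definability over `A` is preserved by substituting, for each variable, another variable or an
element of `A`. -/
theorem definable_subst {A : Set U} {γ δ : Type*} {S : Set (γ → U)} (hS : A.Definable L S)
    (F : (δ → U) → γ → U)
    (hF : ∀ g, (∃ d, ∀ v, F v g = v d) ∨ ∃ x ∈ A, ∀ v, F v g = x) :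
    A.Definable L {v | F v ∈ S} := by
  have hF' : ∀ g, ∃ z : A ⊕ δ, ∀ v, F v g = Sum.elim (↑) v z := by
    intro g
    obtain ⟨d, h⟩ | ⟨x, hx, h⟩ := hF g
    exacts [⟨Sum.inr d, h⟩, ⟨Sum.inl ⟨x, hx⟩, h⟩]
  choose f hf using hF'
  obtain ⟨φ, rfl⟩ := definable_iff_exists_formula_sum.1 hS
  refine definable_iff_exists_formula_sum.2 ⟨φ.relabel (Sum.elim Sum.inl f), ?_⟩
  ext v
  simp only [mem_ofPred_eq, Formula.realize_relabel]
  refine iff_of_eq (congrArg _ ?_)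
  funext z
  cases z with
  | inl a => rfl
  | inr g => simp [hf]

theorem definable_fiber_right {A : Set U} {α β : Type*} {S : Set (α ⊕ β → U)}
    (hS : A.Definable L S) {b : β → U} (hb : ∀ k, b k ∈ A) :
    A.Definable L {v | Sum.elim v b ∈ S} :=
  definable_subst hS (fun v => Sum.elim v b) fun g => by
    cases g with
    | inl d => exact Or.inl ⟨d, fun _ => rfl⟩
    | inr k => exact Or.inr ⟨_, hb k, fun _ => rfl⟩

theorem definable_fiber_left {A : Set U} {α β : Type*} {S : Set (α ⊕ β → U)}
    (hS : A.Definable L S) {a : α → U} (ha : ∀ k, a k ∈ A) :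
    A.Definable L {v | Sum.elim a v ∈ S} :=
  definable_subst hS (fun v => Sum.elim a v) fun g => by
    cases g with
    | inr d => exact Or.inl ⟨d, fun _ => rfl⟩
    | inl k => exact Or.inr ⟨_, ha k, fun _ => rfl⟩

/-- Parameters from the tuple `b` can be turned into variables. -/
theorem exists_definable_fiber_of_union_range {B : Set U} {α β : Type*} {b : β → U}
    {T : Set (α → U)} (hT : (B ∪ range b).Definable L T) :
    ∃ S : Set (α ⊕ β → U), B.Definable L S ∧ T = {v | Sum.elim v b ∈ S} := by
  classical
  obtain ⟨φ, rfl⟩ := definable_iff_exists_formula_sum.1 hT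
  have h : ∀ x : ↥(B ∪ range b), ∃ z : B ⊕ β, (x : U) = Sum.elim (↑) b z := by
    rintro ⟨x, hx | ⟨k, rfl⟩⟩
    exacts [⟨Sum.inl ⟨x, hx⟩, rfl⟩, ⟨Sum.inr k, rfl⟩]
  choose f hf using h
  refine ⟨_, definable_iff_exists_formula_sum.2
    ⟨φ.relabel (Sum.elim (fun x => Sum.map id Sum.inr (f x)) fun a => Sum.inr (Sum.inl a)), rfl⟩, ?_⟩
  ext v
  simp only [mem_ofPred_eq, Formula.realize_relabel]
  refine iff_of_eq (congrArg _ ?_)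
  funext z
  cases z with
  | inr a => rfl
  | inl x =>
    simp only [Sum.elim_inl, Function.comp_apply]
    rw [hf x]
    cases f x <;> rfl

/-- A set definable with arbitrary parameters is a fibre, over a finite tuple, of a set definable
without parameters. -/
theorem exists_empty_definable_fiber {A : Set U} {α : Type*} {T : Set (α → U)}
    (hT : A.Definable L T) :
    ∃ (m : ℕ) (e : Fin m → U) (φ : L.Formula (α ⊕ Fin m)),
      T = {v | φ.Realize (Sum.elim v e)} := by
  obtain ⟨A0, -, hT⟩ := definable_iff_finitely_definable.1 hT
  have : (A0 : Set U) ⊆ ∅ ∪ range (fun k => ((A0.equivFin.symm k : A0) : U)) := by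
    intro x hx
    exact Or.inr ⟨A0.equivFin ⟨x, hx⟩, by simp⟩
  obtain ⟨S, hS, rfl⟩ := exists_definable_fiber_of_union_range (hT.mono this)
  obtain ⟨φ, rfl⟩ := empty_definable_iff.1 hS
  exact ⟨_, _, φ, rfl⟩

/-- `a` realizes over `A` the type that is the limit of `𝒰`: it lies in each `A`-definable set that
belongs to `𝒰`. -/
def Realizes (L : FirstOrder.Language.{u, v}) [L.Structure U] {α : Type*}
    (𝒰 : Ultrafilter (α → U)) (A : Set U) (a : α → U) : Prop :=
  ∀ S : Set (α → U), A.Definable L S → S ∈ 𝒰 → a ∈ S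

theorem Realizes.iff {α : Type*} {𝒰 : Ultrafilter (α → U)} {A : Set U} {a : α → U}
    (h : Realizes L 𝒰 A a) {S : Set (α → U)} (hS : A.Definable L S) : a ∈ S ↔ S ∈ 𝒰 := by
  refine ⟨fun ha => ?_, h S hS⟩
  by_contra hn
  exact h _ hS.compl (Ultrafilter.compl_mem_iff_notMem.2 hn) ha

theorem Realizes.mono {α : Type*} {𝒰 : Ultrafilter (α → U)} {A B : Set U} {a : α → U}
    (h : Realizes L 𝒰 B a) (hAB : A ⊆ B) : Realizes L 𝒰 A a :=
  fun S hS => h S (hS.mono hAB)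

/-- The ultrafilter is concentrated on the tuples from `A`. -/
def ConcentratedOn {α : Type*} (𝒰 : Ultrafilter (α → U)) (A : Set U) : Prop :=
  ∀ᶠ c in (𝒰 : Filter (α → U)), ∀ k, c k ∈ A

/-- The Tarski–Vaught property of an elementary substructure, for definable sets. -/
theorem exists_mem_of_definable (M : L.ElementarySubstructure U) {α : Type*} [Finite α]
    {S : Set (α → U)} (hS : (M : Set U).Definable L S) (hne : S.Nonempty) :
    ∃ c ∈ S, ∀ k, c k ∈ (M : Set U) := by
  obtain ⟨φ, rfl⟩ := definable_iff_exists_formula_sum.1 hS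
  obtain ⟨c, hc⟩ := hne
  have h1 : (φ.iExs α).Realize (M.subtype ∘ (id : M → M)) := by
    rw [Formula.realize_iExs]
    exact ⟨c, hc⟩
  rw [ElementaryEmbedding.map_formula, Formula.realize_iExs] at h1
  obtain ⟨d, hd⟩ := h1
  refine ⟨fun k => d k, ?_, fun k => (d k).2⟩
  rw [← M.subtype.map_formula] at hd
  simp only [mem_ofPred_eq]
  convert hd using 1
  funext z
  cases z <;> rfl

/-- The type of a tuple over an elementary substructure is finitely satisfiable in it, so it is the
limit of an ultrafilter on tuples of the substructure. -/
theorem exists_ultrafilter_realizes (M : L.ElementarySubstructure U) {α : Type*} [Finite α]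
    (e : α → U) :
    ∃ 𝒰 : Ultrafilter (α → U), ConcentratedOn 𝒰 (M : Set U) ∧ Realizes L 𝒰 (M : Set U) e := by
  obtain ⟨𝒰, h1, h2⟩ := exists_ultrafilter_of_inter
    {S : Set (α → U) | (M : Set U).Definable L S ∧ e ∈ S} {c | ∀ k, c k ∈ (M : Set U)}
    ⟨univ, definable_univ, trivial⟩ (fun S hS T hT => ⟨hS.1.inter hT.1, hS.2, hT.2⟩)
    (fun S hS => by
      obtain ⟨c, hc, hc'⟩ := exists_mem_of_definable M hS.1 ⟨e, hS.2⟩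
      exact ⟨c, hc, hc'⟩)
  refine ⟨𝒰, h1, fun S hS hS' => ?_⟩
  by_contra hn
  exact Ultrafilter.compl_mem_iff_notMem.1 (h2 Sᶜ ⟨hS.compl, hn⟩) hS'

end Definable

/-! ### Commuting limits over a stable model -/

section Commute

variable {L : FirstOrder.Language.{u, v}} {U : Type w} [L.Structure U]
  {M : L.ElementarySubstructure U}

theorem not_orderProperty_of_stableIn
    (hst : ∀ (n m : ℕ) (φ : L.Formula (Fin n ⊕ Fin m)), StableIn M φ)
    {α β : Type*} [Finite α] [Finite β] {S : Set (α ⊕ β → U)} (hS : (∅ : Set U).Definable L S)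
    (a : ℕ → α → U) (b : ℕ → β → U) (ha : ∀ i k, a i k ∈ (M : Set U))
    (hb : ∀ i k, b i k ∈ (M : Set U)) :
    ¬ ∀ i j, Sum.elim (a i) (b j) ∈ S ↔ i < j := by
  intro h
  obtain ⟨n, ⟨eα⟩⟩ := Finite.exists_equiv_fin α
  obtain ⟨m, ⟨eβ⟩⟩ := Finite.exists_equiv_fin β
  obtain ⟨φ, rfl⟩ := empty_definable_iff.1 hS
  refine hst n m (φ.relabel (Sum.map eα eβ)) ⟨fun i k => ⟨a i (eα.symm k), ha _ _⟩,
    fun i k => ⟨b i (eβ.symm k), hb _ _⟩, fun i j => ?_⟩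
  rw [← h i j, Formula.realize_relabel, ← M.subtype.map_formula]
  refine iff_of_eq (congrArg _ ?_)
  funext z
  cases z <;> simp

/-- Grothendieck's double limit criterion: iterated limits along ultrafilters on tuples of a stable
model commute. If they do not, sequences with the order property are found by approximating a pair
of independent limits; the two sequences use alternate terms of the approximating sequence, because
nothing is known about the two components of a single term. -/
theorem eventually_comm_of_stableIn
    (hst : ∀ (n m : ℕ) (φ : L.Formula (Fin n ⊕ Fin m)), StableIn M φ)
    {α β : Type*} [Finite α] [Finite β] {S : Set (α ⊕ β → U)} (hS : (∅ : Set U).Definable L S)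
    {𝒰 : Ultrafilter (α → U)} {𝒱 : Ultrafilter (β → U)} (h𝒰 : ConcentratedOn 𝒰 (M : Set U))
    (h𝒱 : ConcentratedOn 𝒱 (M : Set U)) (h : ∀ᶠ c in 𝒰, ∀ᶠ d in 𝒱, Sum.elim c d ∈ S) :
    ∀ᶠ d in 𝒱, ∀ᶠ c in 𝒰, Sum.elim c d ∈ S := by
  by_contra hn
  simp only [← Ultrafilter.eventually_not] at hn
  let 𝒲 : Ultrafilter ((α → U) × (β → U)) :=
    Ultrafilter.of ((𝒰 : Filter (α → U)) ×ˢ (𝒱 : Filter (β → U)))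
  have h1 : ∀ {p : (α → U) → Prop}, (∀ᶠ c in 𝒰, p c) → ∀ᶠ z : (α → U) × (β → U) in 𝒲, p z.1 := fun hp =>
    (tendsto_fst.mono_left (Ultrafilter.of_le _)).eventually hp
  have h2 : ∀ {p : (β → U) → Prop}, (∀ᶠ d in 𝒱, p d) → ∀ᶠ z : (α → U) × (β → U) in 𝒲, p z.2 := fun hp =>
    (tendsto_snd.mono_left (Ultrafilter.of_le _)).eventually hp
  let P : (Fin 2 → (α → U) × (β → U)) → Prop := fun z =>
    ((∀ k, (z 0).1 k ∈ (M : Set U)) ∧ ∀ k, (z 0).2 k ∈ (M : Set U)) ∧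
      Sum.elim (z 0).1 (z 1).2 ∈ S ∧ Sum.elim (z 1).1 (z 0).2 ∉ S
  obtain ⟨g, hg⟩ := exists_seq_of_iterEventually (ι := Unit) 𝒲 (fun _ => 2) (fun _ => P) (by
    intro _
    simp only [IterEventually]
    filter_upwards [h1 h, h2 hn, h1 h𝒰, h2 h𝒱] with z hz hz' hz1 hz2
    filter_upwards [h2 hz, h1 hz'] with z' hzz hzz'
    exact ⟨⟨hz1, hz2⟩, hzz, hzz'⟩)
  obtain ⟨K, hK⟩ := hg ()
  have hP : ∀ i j, K ≤ i → i < j → P ![g i, g j] := by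
    intro i j hi hij
    have hmono : StrictMono (![i, j] : Fin 2 → ℕ) := by
      rw [Fin.strictMono_iff_lt_succ]
      intro l
      fin_cases l
      exact hij
    have := hK ![i, j] hmono (fun l => by fin_cases l <;> simp <;> omega)
    convert this using 1
    funext l
    fin_cases l <;> rfl
  refine not_orderProperty_of_stableIn hst hS (fun i => (g (K + 2 * i + 1)).1)
    (fun j => (g (K + 2 * j)).2) (fun i => (hP _ (K + 2 * i + 2) (by omega) (by omega)).1.1)
    (fun i => (hP _ (K + 2 * i + 1) (by omega) (by omega)).1.2) fun i j => ?_
  constructor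
  · intro hij
    by_contra hlt
    exact (hP (K + 2 * j) (K + 2 * i + 1) (by omega) (by omega)).2.2 hij
  · intro hlt
    exact (hP (K + 2 * i + 1) (K + 2 * j) (by omega) (by omega)).2.1

/-- Over a stable model, iterated limits commute also for sets definable with parameters from the
ambient structure. The parameter tuple is itself approximated by an ultrafilter on tuples of the
model; commuting the limit of the first variable with it and with the second variable, one after
the other, reduces to the case without parameters. -/
theorem eventually_comm_of_stableIn_of_definable
    (hst : ∀ (n m : ℕ) (φ : L.Formula (Fin n ⊕ Fin m)), StableIn M φ)
    {A : Set U} {α β : Type*} [Finite α] [Finite β] {S : Set (α ⊕ β → U)} (hS : A.Definable L S)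
    {𝒰 : Ultrafilter (α → U)} {𝒱 : Ultrafilter (β → U)} (h𝒰 : ConcentratedOn 𝒰 (M : Set U))
    (h𝒱 : ConcentratedOn 𝒱 (M : Set U)) :
    (∀ᶠ c in 𝒰, ∀ᶠ d in 𝒱, Sum.elim c d ∈ S) → ∀ᶠ d in 𝒱, ∀ᶠ c in 𝒰, Sum.elim c d ∈ S := by
  obtain ⟨m, e, φ, rfl⟩ := exists_empty_definable_fiber hS
  obtain ⟨ℰ, hℰ, he⟩ := exists_ultrafilter_realizes M e
  let S' : Set (α ⊕ (β ⊕ Fin m) → U) :=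
    {v | φ.Realize (v ∘ Sum.elim (Sum.map id Sum.inl) (Sum.inr ∘ Sum.inr))}
  have hS' : (∅ : Set U).Definable L S' := by
    refine empty_definable_iff.2 ⟨φ.relabel (Sum.elim (Sum.map id Sum.inl) (Sum.inr ∘ Sum.inr)), ?_⟩
    ext v
    simp [S', Formula.realize_relabel]
  have hSS' : ∀ (c : α → U) (d : β → U) (e : Fin m → U),
      φ.Realize (Sum.elim (Sum.elim c d) e) ↔ Sum.elim c (Sum.elim d e) ∈ S' := by
    intro c d e
    simp only [S', mem_ofPred_eq]
    refine iff_of_eq (congrArg _ ?_)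
    funext z
    rcases z with (_ | _) | _ <;> rfl
  have hfib : ∀ (c : α → U) (d : β → U), (∀ k, c k ∈ (M : Set U)) → (∀ k, d k ∈ (M : Set U)) →
      (φ.Realize (Sum.elim (Sum.elim c d) e) ↔ ∀ᶠ e' in ℰ, Sum.elim c (Sum.elim d e') ∈ S') := by
    intro c d hc hd
    have hdef : (M : Set U).Definable L {e' | Sum.elim c (Sum.elim d e') ∈ S'} :=
      definable_fiber_left (definable_fiber_left (hS'.mono (empty_subset _)) hc) hd
    rw [hSS']
    exact he.iff hdef
  intro h
  have h1 : ∀ᶠ c in 𝒰, ∀ᶠ d in 𝒱, ∀ᶠ e' in ℰ, Sum.elim c (Sum.elim d e') ∈ S' := by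
    filter_upwards [h, h𝒰] with c hc hcM
    filter_upwards [hc, h𝒱] with d hd hdM
    exact (hfib c d hcM hdM).1 hd
  let 𝒢 (d : β → U) : Ultrafilter (β ⊕ Fin m → U) := ℰ.map (Sum.elim d)
  have h𝒢 : ∀ d : β → U, (∀ k, d k ∈ (M : Set U)) → ConcentratedOn (𝒢 d) (M : Set U) := by
    intro d hd
    simp only [ConcentratedOn, 𝒢, Ultrafilter.coe_map, eventually_map]
    filter_upwards [hℰ] with e' he'
    rintro (k | k)
    exacts [hd k, he' k]
  have h𝒱𝒢 : ∀ᶠ d in 𝒱, ConcentratedOn (𝒢 d) (M : Set U) := h𝒱.mono h𝒢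
  have h2 := eventually_comm_of_stableIn hst hS' h𝒰 (𝒱 := 𝒱.bind 𝒢) h𝒱𝒢 (by
      filter_upwards [h1] with c hc
      exact hc)
  have h3 : ∀ᶠ d in 𝒱, ∀ᶠ z in 𝒢 d, ∀ᶠ c in 𝒰, Sum.elim c z ∈ S' := h2
  filter_upwards [h3, h𝒱] with d hd hdM
  -- The complement is commuted here, the implication being stated in one direction only.
  by_contra hn
  have hn' : ∀ᶠ c in 𝒰, ∀ᶠ z in 𝒢 d, Sum.elim c z ∈ S'ᶜ := by
    filter_upwards [Ultrafilter.eventually_not.2 hn, h𝒰] with c hc hcM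
    have := mt (hfib c d hcM hdM).2 hc
    exact Ultrafilter.eventually_not.2 this
  have h4 := eventually_comm_of_stableIn hst hS'.compl h𝒰 (h𝒢 d hdM) hn'
  obtain ⟨z, hz, hz'⟩ := (hd.and h4).exists
  obtain ⟨c, hc, hc'⟩ := (hz.and hz').exists
  exact hc' hc

/-- Over a stable model, a coheir is determined by its restriction to the model. -/
theorem mem_of_agree_of_stableIn
    (hst : ∀ (n m : ℕ) (φ : L.Formula (Fin n ⊕ Fin m)), StableIn M φ)
    {A : Set U} {α : Type*} [Finite α] {𝒰 𝒱 : Ultrafilter (α → U)}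
    (h𝒰 : ConcentratedOn 𝒰 (M : Set U)) (h𝒱 : ConcentratedOn 𝒱 (M : Set U))
    (h : ∀ S, (M : Set U).Definable L S → S ∈ 𝒰 → S ∈ 𝒱)
    {S : Set (α → U)} (hS : A.Definable L S) (hmem : S ∈ 𝒰) : S ∈ 𝒱 := by
  obtain ⟨m, e, φ, rfl⟩ := exists_empty_definable_fiber hS
  obtain ⟨ℰ, hℰ, he⟩ := exists_ultrafilter_realizes M e
  let S' : Set (α ⊕ Fin m → U) := {v | φ.Realize v}
  have hS' : (∅ : Set U).Definable L S' := empty_definable_iff.2 ⟨φ, rfl⟩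
  have hM' : (M : Set U).Definable L S' := hS'.mono (empty_subset _)
  have hfib : ∀ c : α → U, (∀ k, c k ∈ (M : Set U)) →
      (φ.Realize (Sum.elim c e) ↔ ∀ᶠ e' in ℰ, Sum.elim c e' ∈ S') := fun c hc =>
    he.iff (definable_fiber_left hM' hc)
  have h1 : ∀ᶠ c in 𝒰, ∀ᶠ e' in ℰ, Sum.elim c e' ∈ S' := by
    filter_upwards [hmem, h𝒰] with c hc hcM
    exact (hfib c hcM).1 hc
  have h2 := eventually_comm_of_stableIn hst hS' h𝒰 hℰ h1
  by_contra hn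
  have h3 : ∀ᶠ c in 𝒱, ∀ᶠ e' in ℰ, Sum.elim c e' ∈ S'ᶜ := by
    filter_upwards [Ultrafilter.compl_mem_iff_notMem.2 hn, h𝒱] with c hc hcM
    exact Ultrafilter.eventually_not.2 (mt (hfib c hcM).2 hc)
  have h4 := eventually_comm_of_stableIn hst hS'.compl h𝒱 hℰ h3
  obtain ⟨e', ⟨he1, he2⟩, heM⟩ := ((h2.and h4).and hℰ).exists
  have h5 : {c | Sum.elim c e' ∈ S'} ∈ 𝒱 := h _ (definable_fiber_right hM' heM) he1
  obtain ⟨c, hc, hc'⟩ := (Filter.Eventually.and h5 he2).exists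
  exact hc' hc

/-- Symmetry of independence for ultrafilters over a stable model: if `a` realizes `𝒰` over `B`
and `b` realizes `𝒱` over `B ∪ a`, then `a` realizes `𝒰` over `B ∪ b`. -/
theorem Realizes.symm
    (hst : ∀ (n m : ℕ) (φ : L.Formula (Fin n ⊕ Fin m)), StableIn M φ)
    {α β : Type*} [Finite α] [Finite β] {𝒰 : Ultrafilter (α → U)} {𝒱 : Ultrafilter (β → U)}
    (h𝒰 : ConcentratedOn 𝒰 (M : Set U)) (h𝒱 : ConcentratedOn 𝒱 (M : Set U)) {B : Set U}
    (hB : (M : Set U) ⊆ B) {a : α → U} {b : β → U} (ha : Realizes L 𝒰 B a)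
    (hb : Realizes L 𝒱 (B ∪ range a) b) : Realizes L 𝒰 (B ∪ range b) a := by
  intro T hT hmem
  obtain ⟨S, hS, rfl⟩ := exists_definable_fiber_of_union_range hT
  have h1 : ∀ᶠ c in 𝒰, ∀ᶠ d in 𝒱, Sum.elim c d ∈ S := by
    filter_upwards [hmem, h𝒰] with c hc hcM
    exact ((hb.mono subset_union_left).iff
      (definable_fiber_left hS fun k => hB (hcM k))).1 hc
  have h2 := eventually_comm_of_stableIn_of_definable hst hS h𝒰 h𝒱 h1
  have h3 : ∀ᶠ d in 𝒱, Sum.elim a d ∈ S := by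
    filter_upwards [h2, h𝒱] with d hd hdM
    exact ha _ (definable_fiber_right hS fun k => hB (hdM k)) hd
  exact hb _ (definable_fiber_left (hS.mono subset_union_left) fun k => Or.inr ⟨k, rfl⟩) h3

end Commute

/-! ### Morley sequences of ultrafilters -/

section Morley

variable {L : FirstOrder.Language.{u, v}} {U : Type w} [L.Structure U]
  {M : L.ElementarySubstructure U}

/-- The set of entries of the tuples `a j`, for `j ∈ J`. -/
def entries {I α : Type*} (a : I → α → U) (J : Set I) : Set U :=
  {x | ∃ j ∈ J, ∃ k, x = a j k}

theorem entries_mono {I α : Type*} (a : I → α → U) {J K : Set I} (h : J ⊆ K) :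
    entries a J ⊆ entries a K :=
  fun _ ⟨j, hj, k, hx⟩ => ⟨j, h hj, k, hx⟩

/-- Over a stable model, each member of a Morley sequence is independent of all the others, not only
of the earlier ones. -/
theorem realizes_entries_ne
    (hst : ∀ (n m : ℕ) (φ : L.Formula (Fin n ⊕ Fin m)), StableIn M φ)
    {α : Type*} [Finite α] {𝒰 : Ultrafilter (α → U)}
    (h𝒰 : ConcentratedOn 𝒰 (M : Set U)) {I : Type*} [LinearOrder I] {a : I → α → U}
    (ha : ∀ i, Realizes L 𝒰 ((M : Set U) ∪ entries a (Iio i)) (a i)) (i : I) :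
    Realizes L 𝒰 ((M : Set U) ∪ entries a {i}ᶜ) (a i) := by
  classical
  -- By induction on the finite set `J` of other indices, its largest element `m` being added last.
  -- If `m` exceeds `i`, then `a m` is independent of `a i` and symmetry applies.
  have key : ∀ J : Finset I, ∀ i ∉ J, Realizes L 𝒰 ((M : Set U) ∪ entries a (J : Set I)) (a i) := by
    intro J
    induction J using Finset.induction_on_max with
    | empty => exact fun i _ => (ha i).mono (union_subset_union_right _ (entries_mono a (by simp)))
    | insert m J hm ih =>
      intro i hi
      rw [Finset.mem_insert, not_or] at hi
      rcases lt_or_gt_of_ne hi.1 with h | h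
      · have hm' : Realizes L 𝒰 ((M : Set U) ∪ entries a (J : Set I) ∪ range (a i)) (a m) := by
          refine (ha m).mono (union_subset (union_subset_union_right _ (entries_mono a hm)) ?_)
          rintro _ ⟨k, rfl⟩
          exact Or.inr ⟨i, h, k, rfl⟩
        refine (Realizes.symm hst h𝒰 h𝒰 subset_union_left (ih i hi.2) hm').mono ?_
        rw [union_assoc]
        refine union_subset_union_right _ ?_
        rintro x ⟨j, hj, k, rfl⟩
        rcases Finset.mem_insert.1 hj with rfl | hj
        exacts [Or.inr ⟨k, rfl⟩, Or.inl ⟨j, hj, k, rfl⟩]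
      · refine (ha i).mono (union_subset_union_right _ (entries_mono a fun j hj => ?_))
        rcases Finset.mem_insert.1 hj with rfl | hj
        exacts [h, (hm j hj).trans h]
  intro S hS hmem
  obtain ⟨A0, hA0, hS0⟩ := definable_iff_finitely_definable.1 hS
  have hJ : ∃ J : Finset I, i ∉ J ∧ (A0 : Set U) ⊆ (M : Set U) ∪ entries a (J : Set I) := by
    clear hS0
    induction A0 using Finset.induction_on with
    | empty => exact ⟨∅, by simp, by simp⟩
    | insert x A0 _ ih =>
      rw [Finset.coe_insert, insert_subset_iff] at hA0
      obtain ⟨J, hiJ, hJ⟩ := ih hA0.2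
      rcases hA0.1 with hx | ⟨j, hj, k, rfl⟩
      · refine ⟨J, hiJ, ?_⟩
        rw [Finset.coe_insert, insert_subset_iff]
        exact ⟨Or.inl hx, hJ⟩
      · refine ⟨insert j J, by simpa [hiJ] using Ne.symm hj, ?_⟩
        rw [Finset.coe_insert _ A0, insert_subset_iff]
        exact ⟨Or.inr ⟨j, by simp, k, rfl⟩,
          hJ.trans (union_subset_union_right _ (entries_mono a (by simp)))⟩
  obtain ⟨J, hiJ, hJ⟩ := hJ
  exact key J i hiJ S (hS0.mono hJ) hmem

/-- A sequence whose members are each independent of all the others is totally indiscernible: a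
relation definable over the model holds along pairwise distinct members, in whatever order, exactly if
it holds as an iterated limit. -/
theorem iterEventually_iff_of_injective {α : Type*} [Finite α] {𝒰 : Ultrafilter (α → U)}
    (h𝒰 : ConcentratedOn 𝒰 (M : Set U)) {I : Type*} {a : I → α → U}
    (ha : ∀ i, Realizes L 𝒰 ((M : Set U) ∪ entries a {i}ᶜ) (a i)) (k : ℕ)
    (P : (Fin k → α → U) → Prop)
    (hP : (M : Set U).Definable L {v : Fin k × α → U | P fun l x => v (l, x)})
    (i : Fin k → I) (hi : Function.Injective i) :
    P (a ∘ i) ↔ IterEventually 𝒰 k P := by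
  induction k with
  | zero =>
    rw [Subsingleton.elim (a ∘ i) Fin.elim0]
    rfl
  | succ k ih =>
    simp only [IterEventually]
    have h1 : P (a ∘ i) ↔ ∀ᶠ c in 𝒰, P (Fin.cons c (a ∘ i ∘ Fin.succ)) := by
      have hdef : ((M : Set U) ∪ entries a {i 0}ᶜ).Definable L
          {c : α → U | P (Fin.cons c (a ∘ i ∘ Fin.succ))} := by
        refine definable_subst (hP.mono subset_union_left)
          (fun c p => (Fin.cons c (a ∘ i ∘ Fin.succ) : Fin (k + 1) → α → U) p.1 p.2) ?_
        rintro ⟨l, x⟩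
        refine Fin.cases (Or.inl ⟨x, fun _ => rfl⟩) (fun l => Or.inr ⟨_, ?_, fun _ => rfl⟩) l
        refine Or.inr ⟨i l.succ, fun h => ?_, x, rfl⟩
        exact Fin.succ_ne_zero l (hi h)
      have := (ha (i 0)).iff hdef
      rw [mem_ofPred_eq] at this
      refine Iff.trans (iff_of_eq (congrArg P ?_)) this
      funext l
      refine Fin.cases rfl (fun l => rfl) l
    rw [h1]
    refine eventually_congr ?_
    filter_upwards [h𝒰] with c hc
    refine ih (fun e => P (Fin.cons c e)) ?_ (i ∘ Fin.succ) (hi.comp (Fin.succ_injective k))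
    refine definable_subst hP
      (fun v p => (Fin.cons c (fun l x => v (l, x)) : Fin (k + 1) → α → U) p.1 p.2) ?_
    rintro ⟨l, x⟩
    exact Fin.cases (Or.inr ⟨_, hc x, fun _ => rfl⟩) (fun l => Or.inl ⟨(l, x), fun _ => rfl⟩) l

/-- The pattern `E` is realized on the tuple of tuples `e` by the formula `φ(x, y)`: some `b`
satisfies `φ(e k, b)` exactly for those `k` that belong to `E`. -/
def Pattern {n m : ℕ} (φ : L.Formula (Fin n ⊕ Fin m)) {N : ℕ} (E : Set (Fin N))
    (e : Fin N → Fin n → U) : Prop :=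
  ∃ b : Fin m → U, ∀ k, φ.Realize (Sum.elim (e k) b) ↔ k ∈ E

theorem definable_pattern (A : Set U) {n m : ℕ} (φ : L.Formula (Fin n ⊕ Fin m)) {N : ℕ}
    (E : Set (Fin N)) :
    A.Definable L {v : Fin N × Fin n → U | Pattern φ E fun l x => v (l, x)} := by
  classical
  have h0 : A.Definable L {v : Fin n ⊕ Fin m → U | φ.Realize v} :=
    (empty_definable_iff.2 ⟨φ, rfl⟩).mono (empty_subset _)
  have h1 : A.Definable L (⋂ k : Fin N, {v : (Fin N × Fin n) ⊕ Fin m → U |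
      φ.Realize (Sum.elim (fun x => v (Sum.inl (k, x))) fun y => v (Sum.inr y)) ↔ k ∈ E}) := by
    refine definable_iInter_of_finite fun k => ?_
    have h2 : A.Definable L {v : (Fin N × Fin n) ⊕ Fin m → U |
        φ.Realize (Sum.elim (fun x => v (Sum.inl (k, x))) fun y => v (Sum.inr y))} := by
      refine definable_subst h0
        (fun v => Sum.elim (fun x => v (Sum.inl (k, x))) fun y => v (Sum.inr y)) ?_
      rintro (x | y)
      exacts [Or.inl ⟨_, fun _ => rfl⟩, Or.inl ⟨_, fun _ => rfl⟩]
    by_cases hk : k ∈ E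
    · simp only [hk, iff_true]; exact h2
    · simp only [hk, iff_false]; exact h2.compl
  convert h1.exists_of_finite using 1
  ext v
  simp [Pattern]

/-- On tuples from an elementary substructure, patterns are realized in the substructure if they are
realized in the structure. -/
theorem pattern_iff_exists_mem {n m : ℕ} (φ : L.Formula (Fin n ⊕ Fin m)) {N : ℕ} (E : Set (Fin N))
    (e : Fin N → Fin n → M) :
    Pattern φ E (fun k x => (e k x : U)) ↔
      ∃ b : Fin m → M, ∀ k, φ.Realize (Sum.elim (e k) b) ↔ k ∈ E := by
  classical
  have hr : ∀ (c : Fin n → M) (b : Fin m → M),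
      φ.Realize (Sum.elim (fun x => (c x : U)) fun y => (b y : U)) ↔
        φ.Realize (Sum.elim c b) := by
    intro c b
    rw [← M.subtype.map_formula]
    refine iff_of_eq (congrArg _ ?_)
    funext z
    cases z <;> rfl
  constructor
  · rintro ⟨b, hb⟩
    have h0 : (M : Set U).Definable L {v : Fin n ⊕ Fin m → U | φ.Realize v} :=
      (empty_definable_iff.2 ⟨φ, rfl⟩).mono (empty_subset _)
    have h1 : (M : Set U).Definable L (⋂ k : Fin N, {b : Fin m → U |
        φ.Realize (Sum.elim (fun x => (e k x : U)) b) ↔ k ∈ E}) := by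
      refine definable_iInter_of_finite fun k => ?_
      have h2 := definable_fiber_left h0 (a := fun x => (e k x : U)) fun x => (e k x).2
      by_cases hk : k ∈ E
      · simp only [hk, iff_true]; exact h2
      · simp only [hk, iff_false]; exact h2.compl
    obtain ⟨c, hc, hcM⟩ := exists_mem_of_definable M h1 ⟨b, mem_iInter.2 hb⟩
    exact ⟨fun y => ⟨c y, hcM y⟩, fun k => (hr _ _).symm.trans (mem_iInter.1 hc k)⟩
  · rintro ⟨b, hb⟩
    exact ⟨fun y => b y, fun k => (hr _ _).trans (hb k)⟩

end Morley

/-! ### Types and ultrafilters -/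

section TypesAndUltrafilters

variable {L : FirstOrder.Language.{u, v}} {U : Type w} [L.Structure U]

/-- The complete type over `A` to which the ultrafilter `𝒰` on tuples converges. -/
def limitType [Nonempty U] (A : Set U) {n : ℕ} (𝒰 : Ultrafilter (Fin n → U)) : TypeOver L A n where
  toTheory := {φ | ∀ᶠ c : Fin n → U in 𝒰, (Formula.equivSentence.symm φ).Realize c}
  subset' := fun φ hφ => Eventually.of_forall fun c =>
    Theory.CompleteType.mem_typeOf.1 (((L[[A]].completeTheory U).typeOf c).subset hφ)
  isMaximal' := by
    classical
    refine ⟨?_, fun φ => ?_⟩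
    · rw [Theory.isSatisfiable_iff_isFinitelySatisfiable]
      intro T₀ hT₀
      have : ∀ᶠ c : Fin n → U in 𝒰, ∀ φ ∈ T₀, (Formula.equivSentence.symm φ).Realize c :=
        (eventually_all_finset T₀).2 hT₀
      obtain ⟨c, hc⟩ := this.exists
      exact ((L[[A]].completeTheory U).typeOf c).isMaximal.1.mono fun φ hφ =>
        Theory.CompleteType.mem_typeOf.2 (hc φ hφ)
    · by_cases h : ∀ᶠ c : Fin n → U in 𝒰, (Formula.equivSentence.symm φ).Realize c
      · exact Or.inl h
      · refine Or.inr ?_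
        filter_upwards [Ultrafilter.eventually_not.2 h] with c hc
        rw [← Theory.CompleteType.mem_typeOf (T := L[[A]].completeTheory U)] at hc ⊢
        exact (Theory.CompleteType.not_mem_iff _ _).2 hc

theorem mem_formulas_limitType [Nonempty U] {A : Set U} {n : ℕ} {𝒰 : Ultrafilter (Fin n → U)}
    {φ : L[[A]].Formula (Fin n)} :
    φ ∈ TypeOver.formulas (limitType (L := L) A 𝒰) ↔ ∀ᶠ c : Fin n → U in 𝒰, φ.Realize c := by
  change (∀ᶠ c : Fin n → U in 𝒰, (Formula.equivSentence.symm (Formula.equivSentence φ)).Realize c) ↔ _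
  rw [_root_.Equiv.symm_apply_apply]

theorem not_mem_formulas_iff {A : Set U} {n : ℕ} {p : TypeOver L A n}
    {φ : L[[A]].Formula (Fin n)} : φ.not ∈ p.formulas ↔ φ ∉ p.formulas := by
  simp only [TypeOver.formulas, mem_ofPred_eq, Formula.equivSentence_not]
  exact Theory.CompleteType.not_mem_iff _ _

theorem exists_realizes_formulas {A : Set U} {n : ℕ} (p : TypeOver L A n) :
    ∃ (N : Theory.ModelType.{max u w, v, max u v w} (L[[A]].completeTheory U)) (c : Fin n → N),
      ∀ φ, φ ∈ p.formulas ↔ φ.Realize c := by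
  obtain ⟨N, c, rfl⟩ := Theory.exists_modelType_is_realized_in _ p
  exact ⟨N, c, fun φ => Theory.CompleteType.formula_mem_typeOf (T := L[[A]].completeTheory U)⟩

theorem inf_mem_formulas {A : Set U} {n : ℕ} {p : TypeOver L A n}
    {φ ψ : L[[A]].Formula (Fin n)} (hφ : φ ∈ p.formulas) (hψ : ψ ∈ p.formulas) :
    φ ⊓ ψ ∈ p.formulas := by
  obtain ⟨N, c, h⟩ := exists_realizes_formulas p
  rw [h] at *
  exact Formula.realize_inf.2 ⟨hφ, hψ⟩

theorem exists_realize_of_mem_formulas [Nonempty U] {A : Set U} {n : ℕ} {p : TypeOver L A n}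
    {φ : L[[A]].Formula (Fin n)} (hφ : φ ∈ p.formulas) : ∃ c : Fin n → U, φ.Realize c := by
  obtain ⟨N, c, h⟩ := exists_realizes_formulas p
  by_contra hn
  let ψ : L[[A]].Sentence :=
    (φ.relabel (Sum.inr : Fin n → Empty ⊕ Fin n) : L[[A]].Formula (Empty ⊕ Fin n)).iExs (Fin n)
  have hψ : ψ.not ∈ L[[A]].completeTheory U := by
    rw [mem_completeTheory, Sentence.realize_not]
    intro hU
    obtain ⟨d, hd⟩ := Formula.realize_iExs.1 hU
    exact hn ⟨d, by simpa [Formula.realize_relabel] using hd⟩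
  have h1 := N.is_model.realize_of_mem _ hψ
  rw [Sentence.realize_not] at h1
  exact h1 (Formula.realize_iExs.2 ⟨c, by simpa [Formula.realize_relabel] using (h φ).1 hφ⟩)

/-- A complete type, each formula of which is satisfied in `C`, is the limit of an ultrafilter
concentrated on `C`. -/
theorem exists_ultrafilter_of_type {A C : Set U} {n : ℕ} (p : TypeOver L A n)
    (hp : ∀ φ ∈ p.formulas, ∃ a : Fin n → U, (∀ k, a k ∈ C) ∧ φ.Realize a) :
    ∃ 𝒰 : Ultrafilter (Fin n → U), ConcentratedOn 𝒰 C ∧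
      ∀ φ, φ ∈ p.formulas ↔ ∀ᶠ c : Fin n → U in 𝒰, φ.Realize c := by
  obtain ⟨𝒰, h1, h2⟩ := exists_ultrafilter_of_inter
    {S : Set (Fin n → U) | ∃ φ ∈ p.formulas, S = {c | φ.Realize c}} {c | ∀ k, c k ∈ C}
    (by
      obtain ⟨N, c, h⟩ := exists_realizes_formulas p
      exact ⟨_, ⊤, (h ⊤).2 (Formula.realize_top.2 trivial), rfl⟩)
    (by
      rintro _ ⟨φ, hφ, rfl⟩ _ ⟨ψ, hψ, rfl⟩
      refine ⟨_, inf_mem_formulas hφ hψ, ?_⟩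
      ext c
      simp)
    (by
      rintro _ ⟨φ, hφ, rfl⟩
      obtain ⟨a, ha, ha'⟩ := hp φ hφ
      exact ⟨a, ha', ha⟩)
  refine ⟨𝒰, h1, fun φ => ⟨fun h => h2 _ ⟨φ, h, rfl⟩, fun h => ?_⟩⟩
  by_contra hn
  have h3 : ∀ᶠ c : Fin n → U in 𝒰, φ.not.Realize c := h2 _ ⟨_, not_mem_formulas_iff.2 hn, rfl⟩
  obtain ⟨c, hc, hc'⟩ := (h.and h3).exists
  exact hc' hc

theorem realize_toGlobal {A : Set U} {n : ℕ} (φ : L[[A]].Formula (Fin n)) (c : Fin n → U) :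
    (toGlobal φ).Realize c ↔ φ.Realize c :=
  LHom.realize_onFormula _ φ

/-- The ultrafilter `𝒰` converges to the global type `p`. -/
def ConvergesTo {n : ℕ} (𝒰 : Ultrafilter (Fin n → U)) (p : GlobalType L U n) : Prop :=
  ∀ φ, φ ∈ TypeOver.formulas p ↔ ∀ᶠ c : Fin n → U in 𝒰, φ.Realize c

theorem ConvergesTo.realizesOver_iff {n : ℕ} {𝒰 : Ultrafilter (Fin n → U)} {p : GlobalType L U n}
    (h : ConvergesTo 𝒰 p) (A : Set U) (a : Fin n → U) :
    RealizesOver p A a ↔ Realizes L 𝒰 A a := by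
  have h' : ∀ φ : L[[A]].Formula (Fin n), toGlobal φ ∈ TypeOver.formulas p ↔
      ∀ᶠ c : Fin n → U in 𝒰, φ.Realize c := fun φ => by
    simpa only [realize_toGlobal] using h (toGlobal φ)
  simp only [RealizesOver, h']
  constructor
  · rintro ha _ ⟨φ, rfl⟩ hS
    exact ha φ hS
  · intro ha φ hφ
    exact ha _ ⟨φ, rfl⟩ hφ

theorem ConvergesTo.isMorleySequence_iff {n : ℕ} {𝒰 : Ultrafilter (Fin n → U)}
    {p : GlobalType L U n} (h : ConvergesTo 𝒰 p) (A : Set U) {I : Type*} [LinearOrder I]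
    (a : I → Fin n → U) :
    IsMorleySequence p A a ↔ ∀ i, Realizes L 𝒰 (A ∪ entries a (Iio i)) (a i) :=
  forall_congr' fun _ => h.realizesOver_iff _ _

end TypesAndUltrafilters

/-! ### Saturation -/

section Saturation

variable {L : FirstOrder.Language.{u, v}} {U : Type w} [L.Structure U]
  {κ : Cardinal.{w}}

theorem IsSaturated.exists_realizes [Nonempty U] (hU : IsSaturated L U κ) {n : ℕ}
    (𝒰 : Ultrafilter (Fin n → U)) {A : Set U} (hA : #A < κ) : ∃ a, Realizes L 𝒰 A a := by
  obtain ⟨a, ha⟩ := hU A hA n (limitType A 𝒰)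
  refine ⟨a, ?_⟩
  rintro _ ⟨φ, rfl⟩ hS
  exact ha φ (mem_formulas_limitType.2 hS)

theorem mk_union_lt_of_countable (hκ : ℵ₀ < κ) {A B : Set U} (hA : #A < κ) (hB : B.Countable) :
    #(A ∪ B : Set U) < κ :=
  (mk_union_le A B).trans_lt (add_lt_of_lt hκ.le hA (hB.le_aleph0.trans_lt hκ))

theorem countable_entries {I α : Type*} [Finite α] [Countable I] (a : I → α → U) (J : Set I) :
    (entries a J).Countable := by
  refine (countable_range fun z : I × α => a z.1 z.2).mono ?_
  rintro _ ⟨j, -, k, rfl⟩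
  exact ⟨(j, k), rfl⟩

theorem IsSaturated.exists_morley [Nonempty U] (hU : IsSaturated L U κ) (hκ : ℵ₀ < κ) {n : ℕ}
    (𝒰 : Ultrafilter (Fin n → U)) {B : Set U} (hB : #B < κ) :
    ∃ a : ℕ → Fin n → U, ∀ i, Realizes L 𝒰 (B ∪ entries a (Iio i)) (a i) := by
  choose y hy using fun A : {A : Set U // #A < κ} => hU.exists_realizes 𝒰 A.2
  let F : ℕ → {A : Set U // #A < κ} := fun t => Nat.rec ⟨B, hB⟩
    (fun _ A => ⟨A.1 ∪ range (y A), mk_union_lt_of_countable hκ A.2 (countable_range _)⟩) t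
  have hF : ∀ t, (F (t + 1)).1 = (F t).1 ∪ range (y (F t)) := fun t => rfl
  have hmono : Monotone fun t => (F t).1 :=
    monotone_nat_of_le_succ fun t => (hF t).symm ▸ subset_union_left
  refine ⟨fun t => y (F t), fun i => (hy (F i)).mono (union_subset (hmono (Nat.zero_le i)) ?_)⟩
  rintro _ ⟨j, hj, k, rfl⟩
  refine hmono (Nat.succ_le_of_lt hj) ?_
  simp only [hF]
  exact Or.inr ⟨k, rfl⟩

/-- There are a Morley sequence of `𝒰` of order type `ω + ω` and a tuple `b`, put between its two
halves: `b` realizes `𝒱` over `M` and the first half, and the second half is independent from `b`.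
-/
theorem IsSaturated.exists_morley_omega_add_omega [Nonempty U] (hU : IsSaturated L U κ)
    (hκ : ℵ₀ < κ) {M : Set U} (hM : #M < κ) {n m : ℕ} (𝒰 : Ultrafilter (Fin n → U)) (𝒱 : Ultrafilter (Fin m → U)) :
    ∃ (a : ℕ ⊕ₗ ℕ → Fin n → U) (b : Fin m → U),
      (∀ i, Realizes L 𝒰 (M ∪ entries a (Iio i)) (a i)) ∧
      (∀ i, Realizes L 𝒱 (M ∪ range (a (Sum.inlₗ i))) b) ∧
      ∀ i, Realizes L 𝒰 (M ∪ range b) (a (Sum.inrₗ i)) := by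
  obtain ⟨a, ha⟩ := hU.exists_morley hκ 𝒰 hM
  have hA := mk_union_lt_of_countable hκ hM (countable_entries a univ)
  obtain ⟨b, hb⟩ := hU.exists_realizes 𝒱 hA
  obtain ⟨a', ha'⟩ := hU.exists_morley hκ 𝒰 (mk_union_lt_of_countable hκ hA (countable_range b))
  refine ⟨fun i => Sum.elim a a' (ofLex i), b, fun i => ?_, fun i => hb.mono ?_,
    fun i => (ha' i).mono ?_⟩
  · obtain ⟨i, rfl⟩ := toLex.surjective i
    rcases i with i | i
    · refine (ha i).mono (union_subset_union_right _ ?_)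
      rintro _ ⟨j, hj, k, rfl⟩
      obtain ⟨j, rfl⟩ := toLex.surjective j
      rcases j with j | j
      · exact ⟨j, Sum.Lex.inl_lt_inl_iff.1 hj, k, rfl⟩
      · exact absurd hj Sum.Lex.not_inr_lt_inl
    · refine (ha' i).mono (union_subset (fun x hx => Or.inl (Or.inl (Or.inl hx))) ?_)
      rintro _ ⟨j, hj, k, rfl⟩
      obtain ⟨j, rfl⟩ := toLex.surjective j
      rcases j with j | j
      · exact Or.inl (Or.inl (Or.inr ⟨j, trivial, k, rfl⟩))
      · exact Or.inr ⟨j, Sum.Lex.inr_lt_inr_iff.1 hj, k, rfl⟩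
  · rintro x (hx | ⟨k, rfl⟩)
    exacts [Or.inl hx, Or.inr ⟨i, trivial, k, rfl⟩]
  · rintro x (hx | hx)
    exacts [Or.inl (Or.inl (Or.inl hx)), Or.inl (Or.inr hx)]

end Saturation

/-! ### Stability from generically stable types -/

section StableOfGenericallyStable

variable {L : FirstOrder.Language.{u, v}} {U : Type w} [L.Structure U] [Nonempty U]
  {M : L.ElementarySubstructure U} {κ : Cardinal.{w}}

/-- The limit type of `𝒰₀` over `M` extends to a generically stable type, again given by an
ultrafilter on tuples of `M`. -/
theorem exists_generically_stable_ultrafilter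
    (h : ∀ (n : ℕ) (q : TypeOver L (M : Set U) n), ∃ p : GlobalType L U n,
      Extends p q ∧ GenericallyStableOver p (M : Set U))
    {n : ℕ} (𝒰₀ : Ultrafilter (Fin n → U)) :
    ∃ (p : GlobalType L U n) (𝒰 : Ultrafilter (Fin n → U)),
      GenericallyStableOver p (M : Set U) ∧ ConvergesTo 𝒰 p ∧ ConcentratedOn 𝒰 (M : Set U) ∧
      ∀ S, (M : Set U).Definable L S → S ∈ 𝒰₀ → S ∈ 𝒰 := by
  obtain ⟨p, hpq, hp⟩ := h n (limitType (M : Set U) 𝒰₀)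
  obtain ⟨𝒰, h𝒰, h𝒰p⟩ := exists_ultrafilter_of_type p hp.1
  refine ⟨p, 𝒰, hp, h𝒰p, h𝒰, ?_⟩
  rintro _ ⟨φ, rfl⟩ hS
  have := (h𝒰p _).1 (hpq φ (mem_formulas_limitType.2 hS))
  simp only [realize_toGlobal] at this
  exact this

/-- A generically stable type commutes with every coheir: in a Morley sequence of order type
`ω + ω`, with a realization `b` of the other type put between the two halves, the first half shows
one iterated limit and the second half the other. -/
theorem eventually_comm_of_genericallyStable (hκ : ℵ₀ < κ) (hM : #M < κ) (hU : IsSaturated L U κ)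
    {n m : ℕ} {p : GlobalType L U n} {𝒰 : Ultrafilter (Fin n → U)} {𝒱 : Ultrafilter (Fin m → U)}
    (hp : GenericallyStableOver p (M : Set U)) (h𝒰p : ConvergesTo 𝒰 p)
    (h𝒰 : ConcentratedOn 𝒰 (M : Set U)) (h𝒱 : ConcentratedOn 𝒱 (M : Set U))
    {S : Set (Fin n ⊕ Fin m → U)} (hS : (M : Set U).Definable L S) :
    (∀ᶠ c in 𝒰, ∀ᶠ d in 𝒱, Sum.elim c d ∈ S) ↔ ∀ᶠ d in 𝒱, ∀ᶠ c in 𝒰, Sum.elim c d ∈ S := by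
  obtain ⟨a, b, ha, hb, ha'⟩ := hU.exists_morley_omega_add_omega hκ (M := (M : Set U)) hM 𝒰 𝒱
  -- On the first half, `b` comes after `a i`; on the second half, it comes before.
  have h1 : ∀ i, Sum.elim (a (Sum.inlₗ i)) b ∈ S ↔ ∀ᶠ d in 𝒱, ∀ᶠ c in 𝒰, Sum.elim c d ∈ S := by
    intro i
    refine Iff.trans ((hb i).iff (definable_fiber_left (hS.mono subset_union_left)
      fun k => Or.inr ⟨k, rfl⟩)) (eventually_congr ?_)
    filter_upwards [h𝒱] with d hd
    exact ((ha (Sum.inlₗ i)).mono subset_union_left).iff (definable_fiber_right hS hd)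
  have h2 : ∀ i, Sum.elim (a (Sum.inrₗ i)) b ∈ S ↔ ∀ᶠ c in 𝒰, ∀ᶠ d in 𝒱, Sum.elim c d ∈ S := by
    intro i
    refine Iff.trans ((ha' i).iff (definable_fiber_right (hS.mono subset_union_left)
      fun k => Or.inr ⟨k, rfl⟩)) (eventually_congr ?_)
    filter_upwards [h𝒰] with c hc
    exact ((hb 0).mono subset_union_left).iff (definable_fiber_left hS hc)
  obtain ⟨ψ, hψ⟩ : (univ : Set U).Definable L {c | Sum.elim c b ∈ S} :=
    definable_fiber_right (hS.mono (subset_univ _)) fun _ => trivial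
  have hψ' : ∀ c, ψ.Realize c ↔ Sum.elim c b ∈ S := fun c => (Set.ext_iff.1 hψ c).symm
  have hinl : Function.Injective (Sum.inlₗ : ℕ → ℕ ⊕ₗ ℕ) := fun _ _ h => Sum.inl_injective h
  have hinr : Function.Injective (Sum.inrₗ : ℕ → ℕ ⊕ₗ ℕ) := fun _ _ h => Sum.inr_injective h
  have hfin := hp.2 a ((h𝒰p.isMorleySequence_iff _ a).2 ha) ψ
  simp only [hψ'] at hfin
  constructor
  · intro h
    by_contra hn
    rcases hfin with hfin | hfin
    · exact infinite_range_of_injective hinr (hfin.subset (by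
        rintro _ ⟨i, rfl⟩; exact (h2 i).2 h))
    · exact infinite_range_of_injective hinl (hfin.subset (by
        rintro _ ⟨i, rfl⟩; exact mt (h1 i).1 hn))
  · intro h
    by_contra hn
    rcases hfin with hfin | hfin
    · exact infinite_range_of_injective hinl (hfin.subset (by
        rintro _ ⟨i, rfl⟩; exact (h1 i).2 h))
    · exact infinite_range_of_injective hinr (hfin.subset (by
        rintro _ ⟨i, rfl⟩; exact mt (h2 i).1 hn))

/-- The limits of the two sequences of an instance of the order property fail to commute. Replacing
them by generically stable types with the same restrictions to the model, one at a time in the inner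
limit, shows that they do commute. -/
theorem stableIn_of_genericallyStable (hκ : ℵ₀ < κ) (hM : #M < κ) (hU : IsSaturated L U κ)
    (h : ∀ (n : ℕ) (q : TypeOver L (M : Set U) n), ∃ p : GlobalType L U n,
      Extends p q ∧ GenericallyStableOver p (M : Set U))
    {n m : ℕ} (φ : L.Formula (Fin n ⊕ Fin m)) : StableIn M φ := by
  rintro ⟨a, b, hab⟩
  let S : Set (Fin n ⊕ Fin m → U) := {v | φ.Realize v}
  have hS : (M : Set U).Definable L S :=
    (empty_definable_iff.2 ⟨φ, rfl⟩).mono (empty_subset _)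
  have hS' : (M : Set U).Definable L {v : Fin m ⊕ Fin n → U | v ∘ Sum.swap ∈ S} :=
    hS.preimage_comp Sum.swap
  have hswap : ∀ (c : Fin n → U) (d : Fin m → U),
      Sum.elim d c ∈ {v : Fin m ⊕ Fin n → U | v ∘ Sum.swap ∈ S} ↔ Sum.elim c d ∈ S := by
    intro c d
    refine iff_of_eq (congrArg (· ∈ S) ?_)
    funext z
    cases z <;> rfl
  have habS : ∀ i j, Sum.elim (fun x => (a i x : U)) (fun y => (b j y : U)) ∈ S ↔ i < j := by
    intro i j
    rw [← hab i j, ← M.subtype.map_formula]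
    refine iff_of_eq (congrArg _ ?_)
    funext z
    cases z <;> rfl
  let 𝒰₀ : Ultrafilter (Fin n → U) := (hyperfilter ℕ).map fun i x => a i x
  let 𝒱₀ : Ultrafilter (Fin m → U) := (hyperfilter ℕ).map fun j y => b j y
  have h𝒰₀ : ConcentratedOn 𝒰₀ (M : Set U) :=
    Eventually.of_forall (f := (hyperfilter ℕ : Filter ℕ)) fun i x => (a i x).2
  have h𝒱₀ : ConcentratedOn 𝒱₀ (M : Set U) :=
    Eventually.of_forall (f := (hyperfilter ℕ : Filter ℕ)) fun j y => (b j y).2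
  obtain ⟨p, 𝒰, hp, h𝒰p, h𝒰, h𝒰𝒰₀⟩ := exists_generically_stable_ultrafilter h 𝒰₀
  obtain ⟨r, 𝒱, hr, h𝒱r, h𝒱, h𝒱𝒱₀⟩ := exists_generically_stable_ultrafilter h 𝒱₀
  have hinner : ∀ d : Fin m → U, (∀ k, d k ∈ (M : Set U)) →
      (∀ᶠ c in 𝒰₀, Sum.elim c d ∈ S) → ∀ᶠ c in 𝒰, Sum.elim c d ∈ S :=
    fun d hd => h𝒰𝒰₀ _ (definable_fiber_right hS hd)
  have hinner' : ∀ c : Fin n → U, (∀ k, c k ∈ (M : Set U)) →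
      (∀ᶠ d in 𝒱₀, Sum.elim c d ∈ S) → ∀ᶠ d in 𝒱, Sum.elim c d ∈ S :=
    fun c hc => h𝒱𝒱₀ _ (definable_fiber_left hS hc)
  have hgt : ∀ i : ℕ, ∀ᶠ j : ℕ in hyperfilter ℕ, i < j := fun i =>
    Nat.hyperfilter_le_atTop (eventually_gt_atTop i)
  have h1 : ∀ᶠ c in 𝒰₀, ∀ᶠ d in 𝒱₀, Sum.elim c d ∈ S :=
    Eventually.of_forall (f := (hyperfilter ℕ : Filter ℕ)) fun i =>
      (hgt i).mono fun j hij => (habS i j).2 hij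
  have h2 : ∀ᶠ c in 𝒰₀, ∀ᶠ d in 𝒱, Sum.elim c d ∈ S := by
    filter_upwards [h1, h𝒰₀] with c hc hcM
    exact hinner' c hcM hc
  have h3 : ∀ᶠ d in 𝒱, ∀ᶠ c in 𝒰₀, Sum.elim c d ∈ S := by
    have := (eventually_comm_of_genericallyStable hκ hM hU hr h𝒱r h𝒱 h𝒰₀ hS').2
    simp only [hswap] at this
    exact this h2
  have h4 : ∀ᶠ d in 𝒱, ∀ᶠ c in 𝒰, Sum.elim c d ∈ S := by
    filter_upwards [h3, h𝒱] with d hd hdM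
    exact hinner d hdM hd
  have h5 := (eventually_comm_of_genericallyStable hκ hM hU hp h𝒰p h𝒰 h𝒱 hS).2 h4
  have h6 : ∀ᶠ c in 𝒰, ∀ᶠ d in 𝒱₀, Sum.elim c d ∈ S := by
    filter_upwards [h5, h𝒰] with c hc hcM
    by_contra hn
    have := h𝒱𝒱₀ _ (definable_fiber_left hS hcM).compl (Ultrafilter.compl_mem_iff_notMem.2 hn)
    exact Ultrafilter.compl_mem_iff_notMem.1 this hc
  have h7 := (eventually_comm_of_genericallyStable hκ hM hU hp h𝒰p h𝒰 h𝒱₀ hS).1 h6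
  have h8 : ∀ᶠ d in 𝒱₀, ∀ᶠ c in 𝒰₀, Sum.elim c d ∈ S := by
    filter_upwards [h7, h𝒱₀] with d hd hdM
    by_contra hn
    have := h𝒰𝒰₀ _ (definable_fiber_right hS hdM).compl (Ultrafilter.compl_mem_iff_notMem.2 hn)
    exact Ultrafilter.compl_mem_iff_notMem.1 this hd
  have h9 : ∀ᶠ j : ℕ in hyperfilter ℕ, ∀ᶠ i : ℕ in hyperfilter ℕ, i < j := by
    have h8' : ∀ᶠ j : ℕ in hyperfilter ℕ, ∀ᶠ i : ℕ in hyperfilter ℕ,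
      Sum.elim (fun x => (a i x : U)) (fun y => (b j y : U)) ∈ S := h8
    simpa only [habS] using h8'
  obtain ⟨j, hj⟩ := h9.exists
  obtain ⟨i, hij, hji⟩ := (hj.and (hgt j)).exists
  exact lt_asymm hij hji

end StableOfGenericallyStable

/-! ### Eventual dependence from generically stable types -/

section EventuallyDependent

variable {L : FirstOrder.Language.{u, v}} {U : Type w} [L.Structure U]
  {M : L.ElementarySubstructure U} {κ : Cardinal.{w}}

theorem countable_formula [Countable L.Symbols] {α : Type*} [Finite α] :
    Countable (L.Formula α) := by
  have h1 : #(Σ n, L.BoundedFormula α n) ≤ ℵ₀ := by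
    refine BoundedFormula.card_le.trans (max_le le_rfl ?_)
    refine add_le_aleph0.2 ⟨?_, ?_⟩
    · simp
    · rw [lift_le_aleph0]
      exact mk_le_aleph0_iff.2 ‹_›
  have : Countable (Σ n, L.BoundedFormula α n) := mk_le_aleph0_iff.1 h1
  exact Function.Injective.countable (β := Σ n, L.BoundedFormula α n)
    (f := fun φ : L.Formula α => ⟨0, φ⟩)
    fun _ _ h => eq_of_heq (Sigma.mk.inj h).2

/-- In a countable language there is a sequence along which, for every formula, the realized
patterns are eventually those that are realized in the iterated limit. The relation `R`, holding
between independent limits, can be imposed on the sequence. -/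
theorem exists_seq_pattern_iff [Countable L.Symbols] {I : Type*} (𝒲 : Ultrafilter I) {n : ℕ}
    (c : I → Fin n → U) (R : I → I → Prop) (hR : ∀ᶠ x in 𝒲, ∀ᶠ y in 𝒲, R x y) :
    ∃ g : ℕ → I, (∀ i j, i < j → R (g i) (g j)) ∧
      ∀ (m : ℕ) (φ : L.Formula (Fin n ⊕ Fin m)) (N : ℕ) (E : Set (Fin N)), ∃ K : ℕ,
        ∀ i : Fin N → ℕ, StrictMono i → (∀ l, K ≤ i l) →
          (Pattern φ E (c ∘ g ∘ i) ↔ IterEventually (𝒲.map c) N (Pattern φ E)) := by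
  let ι := Σ m, L.Formula (Fin n ⊕ Fin m) × Σ N, Set (Fin N)
  have : ∀ m, Countable (L.Formula (Fin n ⊕ Fin m)) := fun m => countable_formula
  let k : Option ι → ℕ := fun s => s.elim 2 fun s => s.2.2.1
  let P : (s : Option ι) → (Fin (k s) → I) → Prop := fun s => match s with
    | none => fun e : Fin 2 → I => R (e 0) (e 1)
    | some s => fun e : Fin s.2.2.1 → I => Pattern s.2.1 s.2.2.2 (c ∘ e) ↔
        IterEventually (𝒲.map c) s.2.2.1 (Pattern s.2.1 s.2.2.2)
  have hP : ∀ s, IterEventually 𝒲 (k s) (P s) := by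
    rintro (_ | ⟨m, φ, N, E⟩)
    · exact hR
    · change IterEventually 𝒲 N fun e => Pattern φ E (c ∘ e) ↔
        IterEventually (𝒲.map c) N (Pattern φ E)
      by_cases h : IterEventually (𝒲.map c) N (Pattern φ E)
      · simp only [h, iff_true]
        exact (iterEventually_map 𝒲 c N _).1 h
      · simp only [h, iff_false]
        exact (iterEventually_map 𝒲 c N (fun e => ¬ Pattern φ E e)).1
          ((iterEventually_not _ _ _).2 h)
  obtain ⟨g, hg⟩ := exists_seq_of_iterEventually 𝒲 k P hP
  obtain ⟨K₀, hK₀⟩ := hg none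
  refine ⟨fun t => g (K₀ + t), fun i j hij => ?_, fun m φ N E => ?_⟩
  · have hmono : StrictMono (![K₀ + i, K₀ + j] : Fin 2 → ℕ) := by
      rw [Fin.strictMono_iff_lt_succ]
      intro l
      fin_cases l
      exact Nat.add_lt_add_left hij _
    refine hK₀ ![K₀ + i, K₀ + j] hmono fun l => ?_
    induction l using Fin.cases with
    | zero => exact Nat.le_add_right _ _
    | succ l =>
      rw [Subsingleton.elim l 0]
      exact Nat.le_add_right _ _
  · obtain ⟨K, hK⟩ := hg (some ⟨m, φ, N, E⟩)
    exact ⟨K, fun i hi hKi => hK (fun l => K₀ + i l) (fun _ _ h => Nat.add_lt_add_left (hi h) _)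
      fun l => (hKi l).trans (Nat.le_add_left _ _)⟩

theorem val_le_of_strictMono {N : ℕ} {i : Fin N → ℕ} (hi : StrictMono i) (k : Fin N) :
    (k : ℕ) ≤ i k := by
  obtain ⟨k, hk⟩ := k
  induction k with
  | zero => exact Nat.zero_le _
  | succ k ih =>
    exact (Nat.succ_le_succ (ih (by omega))).trans
      (Nat.succ_le_of_lt (hi (Fin.mk_lt_mk.2 (Nat.lt_succ_self k))))

/-- Dependence of a formula along a sequence may be checked on a tail: the omitted pattern is
preceded by arbitrary entries, which push the indices beyond any given bound. -/
theorem dependentAlong_of_eventually {n m N K : ℕ} {φ : L.Formula (Fin n ⊕ Fin m)}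
    {E : Set (Fin N)} {c : ℕ → Fin n → M}
    (h : ∀ i : Fin N → ℕ, StrictMono i → (∀ l, K ≤ i l) →
      ¬ Pattern φ E fun l x => (c (i l) x : U)) :
    DependentAlong φ c := by
  refine ⟨K + N, Fin.natAdd K '' E, fun i hi hb => ?_⟩
  obtain ⟨b, hb⟩ := hb
  refine h (i ∘ Fin.natAdd K) (hi.comp (Fin.strictMono_natAdd K)) (fun l => ?_)
    ((pattern_iff_exists_mem φ E _).2 ⟨b, fun l => (hb (Fin.natAdd K l)).trans ?_⟩)
  · exact le_trans (by simp) (val_le_of_strictMono hi (Fin.natAdd K l))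
  · exact (Fin.natAdd_injective N K).mem_set_image

/-- If all patterns of `φ` are realized along the finite subfamilies of `a`, then each subset of the
countable index set is cut out by `φ`. -/
theorem IsSaturated.exists_realize_iff_mem [Nonempty U] (hU : IsSaturated L U κ) (hκ : ℵ₀ < κ)
    {n m : ℕ} {φ : L.Formula (Fin n ⊕ Fin m)} {I : Type*} [Countable I] {a : I → Fin n → U}
    (h : ∀ (N : ℕ) (E : Set (Fin N)) (i : Fin N → I), Function.Injective i → Pattern φ E (a ∘ i))
    (J : Set I) : ∃ b : Fin m → U, ∀ i, φ.Realize (Sum.elim (a i) b) ↔ i ∈ J := by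
  classical
  let T : I → Set (Fin m → U) := fun i => {b | φ.Realize (Sum.elim (a i) b) ↔ i ∈ J}
  obtain ⟨𝒱, -, h𝒱⟩ := exists_ultrafilter_of_inter
    {S | ∃ F : Finset I, S = ⋂ i ∈ F, T i} univ ⟨_, ∅, rfl⟩ (by
      rintro _ ⟨F, rfl⟩ _ ⟨F', rfl⟩
      exact ⟨F ∪ F', (Finset.inf_set_eq_iInter F T ▸ Finset.inf_set_eq_iInter F' T ▸
        Finset.inf_set_eq_iInter (F ∪ F') T ▸ Finset.inf_union.symm)⟩) (by
      rintro _ ⟨F, rfl⟩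
      obtain ⟨b, hb⟩ := h F.card {k | (F.equivFin.symm k : I) ∈ J}
        (fun k => (F.equivFin.symm k : I)) (Subtype.val_injective.comp F.equivFin.symm.injective)
      refine ⟨b, mem_iInter₂.2 fun i hi => ?_, trivial⟩
      have := hb (F.equivFin ⟨i, hi⟩)
      simpa only [T, mem_ofPred_eq, Function.comp_apply, Equiv.symm_apply_apply] using this)
  obtain ⟨b, hb⟩ := hU.exists_realizes 𝒱 (((countable_entries a univ).le_aleph0).trans_lt hκ)
  refine ⟨b, fun i => hb (T i) ?_ ?_⟩
  · have h0 : (entries a univ).Definable L {v : Fin n ⊕ Fin m → U | φ.Realize v} :=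
      (empty_definable_iff.2 ⟨φ, rfl⟩).mono (empty_subset _)
    have h1 := definable_fiber_left h0 (a := a i) fun k => ⟨i, trivial, k, rfl⟩
    by_cases hi : i ∈ J
    · simp only [T, hi, iff_true]
      exact h1
    · simp only [T, hi, iff_false]
      exact h1.compl
  · exact h𝒱 _ ⟨{i}, by simp⟩

/-- The subsequence is chosen to realize the same patterns as the limit of the sequence. That limit,
being the unique coheir of its restriction to the model, is generically stable. -/
theorem eventuallyDependent_of_genericallyStable [Countable L.Symbols] [Nonempty U]
    (hκ : ℵ₀ < κ) (hM : #M < κ) (hU : IsSaturated L U κ)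
    (h : ∀ (n : ℕ) (q : TypeOver L (M : Set U) n), ∃ p : GlobalType L U n,
      Extends p q ∧ GenericallyStableOver p (M : Set U)) : EventuallyDependent L M := by
  intro n c
  have hst : ∀ (n m : ℕ) (φ : L.Formula (Fin n ⊕ Fin m)), StableIn M φ := fun _ _ φ =>
    stableIn_of_genericallyStable hκ hM hU h φ
  let c' : ℕ → Fin n → U := fun i x => c i x
  let 𝒰₀ : Ultrafilter (Fin n → U) := (hyperfilter ℕ).map c'
  have h𝒰₀ : ConcentratedOn 𝒰₀ (M : Set U) :=
    Eventually.of_forall (f := (hyperfilter ℕ : Filter ℕ)) fun i x => (c i x).2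
  obtain ⟨p, 𝒰, hp, h𝒰p, h𝒰, h𝒰𝒰₀⟩ := exists_generically_stable_ultrafilter h 𝒰₀
  obtain ⟨g, hg, hpat⟩ := exists_seq_pattern_iff (L := L) (hyperfilter ℕ) c' (· < ·)
    (Eventually.of_forall fun i => Nat.hyperfilter_le_atTop (eventually_gt_atTop i))
  refine ⟨g, fun i j => hg i j, fun m φ => ?_⟩
  by_contra hnd
  -- If `φ` is not dependent along the subsequence, then every pattern is realized in the limit.
  have hiter : ∀ N (E : Set (Fin N)), IterEventually 𝒰₀ N (Pattern φ E) := by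
    intro N E
    by_contra hn
    obtain ⟨K, hK⟩ := hpat m φ N E
    exact hnd (dependentAlong_of_eventually (K := K) fun i hi hKi hpatt =>
      hn ((hK i hi hKi).1 hpatt))
  obtain ⟨a, -, ha, -⟩ := hU.exists_morley_omega_add_omega hκ (M := (M : Set U)) hM 𝒰 𝒰
  have hind : ∀ i, Realizes L 𝒰₀ ((M : Set U) ∪ entries a {i}ᶜ) (a i) := fun i S hS hmem =>
    realizes_entries_ne hst h𝒰 ha i S hS (mem_of_agree_of_stableIn hst h𝒰₀ h𝒰 h𝒰𝒰₀ hS hmem)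
  have : Countable (ℕ ⊕ₗ ℕ) := inferInstanceAs (Countable (ℕ ⊕ ℕ))
  obtain ⟨b, hb⟩ := hU.exists_realize_iff_mem hκ (a := a) (φ := φ) (fun N E i hi =>
    (iterEventually_iff_of_injective h𝒰₀ hind N _ (definable_pattern _ φ E) i hi).2 (hiter N E))
    (range Sum.inlₗ)
  obtain ⟨ψ, hψ⟩ : (univ : Set U).Definable L {x | φ.Realize (Sum.elim x b)} :=
    definable_fiber_right (S := {v : Fin n ⊕ Fin m → U | φ.Realize v})
      ((empty_definable_iff.2 ⟨φ, rfl⟩).mono (empty_subset _)) fun _ => trivial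
  have hψ' : ∀ i, ψ.Realize (a i) ↔ i ∈ range Sum.inlₗ := fun i =>
    (Set.ext_iff.1 hψ (a i)).symm.trans (hb i)
  rcases hp.2 a ((h𝒰p.isMorleySequence_iff _ a).2 ha) ψ with hfin | hfin
  · refine infinite_range_of_injective (f := (Sum.inlₗ : ℕ → ℕ ⊕ₗ ℕ))
      (fun _ _ h => Sum.inl_injective h) (hfin.subset fun i hi => (hψ' i).2 hi)
  · refine infinite_range_of_injective (f := (Sum.inrₗ : ℕ → ℕ ⊕ₗ ℕ))
      (fun _ _ h => Sum.inr_injective h) (hfin.subset ?_)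
    rintro _ ⟨i, rfl⟩
    refine mt (hψ' _).1 ?_
    rintro ⟨j, hj⟩
    exact Sum.inl_ne_inr hj

end EventuallyDependent

/-! ### Generically stable types from eventual stability -/

section GenericallyStableOfEventuallyStable

variable {L : FirstOrder.Language.{u, v}} {U : Type w} [L.Structure U]
  {M : L.ElementarySubstructure U}

/-- Over an eventually stable model every coheir is generically stable: an instance of a formula that
is neither finite nor cofinite along a Morley sequence leads to a sequence in the model without a
subsequence along which the formula is dependent. -/
theorem genericallyStableOver_of_eventuallyStable [Countable L.Symbols]
    (hM : EventuallyStable L M) {n : ℕ} {p : GlobalType L U n} {𝒰 : Ultrafilter (Fin n → U)}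
    (h𝒰 : ConcentratedOn 𝒰 (M : Set U)) (h𝒰p : ConvergesTo 𝒰 p) :
    GenericallyStableOver p (M : Set U) := by
  classical
  refine ⟨fun φ hφ => ?_, fun a ha φ => ?_⟩
  · obtain ⟨c, hc, hc'⟩ := (((h𝒰p φ).1 hφ).and h𝒰).exists
    exact ⟨c, hc', hc⟩
  by_contra hinf
  rw [not_or] at hinf
  obtain ⟨m, e, φ', hφ'⟩ := exists_empty_definable_fiber
    (⟨φ, rfl⟩ : (univ : Set U).Definable L {c : Fin n → U | φ.Realize c})
  have hφφ' : ∀ c, φ.Realize c ↔ φ'.Realize (Sum.elim c e) := fun c => Set.ext_iff.1 hφ' c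
  have hind := realizes_entries_ne hM.1 h𝒰 ((h𝒰p.isMorleySequence_iff _ a).1 ha)
  obtain ⟨g, hg, hpat⟩ := exists_seq_pattern_iff (L := L) 𝒰 id (fun c _ => ∀ k, c k ∈ (M : Set U))
    (h𝒰.mono fun c hc => Eventually.of_forall fun _ => hc)
  have hgM : ∀ t k, g t k ∈ (M : Set U) := fun t => hg t (t + 1) (Nat.lt_succ_self t)
  obtain ⟨h, hmono, hdep⟩ := hM.2 n fun t k => ⟨g t k, hgM t k⟩
  obtain ⟨N, E, hNE⟩ := hdep m φ'
  -- By infinity of both sets, the pattern is realized by `e` along some members of the sequence.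
  obtain ⟨f₁, hf₁⟩ : ∃ f : ℕ → ℕ ⊕ₗ ℕ, Function.Injective f ∧ ∀ t, φ.Realize (a (f t)) :=
    ⟨_, (Subtype.val_injective.comp (Set.Infinite.natEmbedding _ hinf.1).injective),
      fun t => (Set.Infinite.natEmbedding _ hinf.1 t).2⟩
  obtain ⟨f₂, hf₂⟩ : ∃ f : ℕ → ℕ ⊕ₗ ℕ, Function.Injective f ∧ ∀ t, ¬ φ.Realize (a (f t)) :=
    ⟨_, (Subtype.val_injective.comp (Set.Infinite.natEmbedding _ hinf.2).injective),
      fun t => (Set.Infinite.natEmbedding _ hinf.2 t).2⟩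
  let i : Fin N → ℕ ⊕ₗ ℕ := fun k => if k ∈ E then f₁ k else f₂ k
  have hi : ∀ k, φ.Realize (a (i k)) ↔ k ∈ E := by
    intro k
    by_cases hk : k ∈ E
    · simpa only [i, hk, if_true, iff_true] using hf₁.2 k
    · simpa only [i, hk, if_false, iff_false] using hf₂.2 k
  have hinj : Function.Injective i := by
    intro k l hkl
    have hE : k ∈ E ↔ l ∈ E := by rw [← hi k, ← hi l, hkl]
    by_cases hl : l ∈ E
    · simp only [i, hE, hl, if_true] at hkl
      exact Fin.ext (hf₁.1 hkl)
    · simp only [i, hE, hl, if_false] at hkl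
      exact Fin.ext (hf₂.1 hkl)
  have hiter : IterEventually 𝒰 N (Pattern φ' E) :=
    (iterEventually_iff_of_injective h𝒰 hind N _ (definable_pattern _ φ' E) i hinj).1
      ⟨e, fun k => (hφφ' _).symm.trans (hi k)⟩
  obtain ⟨K, hK⟩ := hpat m φ' N E
  refine hNE (fun l => K + l) (fun _ _ hlt => Nat.add_lt_add_left hlt _)
    ((pattern_iff_exists_mem φ' E _).1 ?_)
  refine (hK (fun l => h (K + l)) (fun _ _ hlt => hmono (Nat.add_lt_add_left hlt _))
    fun l => (Nat.le_add_right K l).trans (hmono.le_apply)).2 ?_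
  simpa using hiter

theorem exists_extends_genericallyStable [Countable L.Symbols] [Nonempty U]
    (hM : EventuallyStable L M) {n : ℕ} (q : TypeOver L (M : Set U) n) :
    ∃ p : GlobalType L U n, Extends p q ∧ GenericallyStableOver p (M : Set U) := by
  obtain ⟨𝒰, h𝒰, h𝒰q⟩ := exists_ultrafilter_of_type (C := (M : Set U)) q fun φ hφ => by
    obtain ⟨c, hc, hcM⟩ := exists_mem_of_definable M ⟨φ, rfl⟩ (exists_realize_of_mem_formulas hφ)
    exact ⟨c, hcM, hc⟩
  refine ⟨limitType univ 𝒰, fun φ hφ => mem_formulas_limitType.2 ?_,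
    genericallyStableOver_of_eventuallyStable hM h𝒰 fun φ => mem_formulas_limitType⟩
  simpa only [realize_toGlobal] using (h𝒰q φ).1 hφ

end GenericallyStableOfEventuallyStable

end EventualStability

theorem theorem5p5 {L : FirstOrder.Language.{u, v}} [Countable L.Symbols] (T : L.Theory)
    {U : Type w} [L.Structure U] [Nonempty U] (M : L.ElementarySubstructure U) [M ⊨ T]
    (κ : Cardinal.{w}) (hκ : ℵ₀ < κ) (hM : #M < κ) (hU : EventualStability.IsSaturated L U κ) :
    EventualStability.EventuallyStable L M ↔
      ∀ (n : ℕ) (q : EventualStability.TypeOver L (M : Set U) n),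
        ∃ p : EventualStability.GlobalType L U n,
          EventualStability.Extends p q ∧
            EventualStability.GenericallyStableOver p (M : Set U) :=
  ⟨fun h _ q => EventualStability.exists_extends_genericallyStable h q, fun h =>
    ⟨fun _ _ φ => EventualStability.stableIn_of_genericallyStable hκ hM hU h φ,
      EventualStability.eventuallyDependent_of_genericallyStable hκ hM hU h⟩⟩
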